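/- Let $E$ be a (real) Banach lattice. For $n\in\{1,2,3,\dots\}$, a function $P\colon E\to\mathbb R$ is a positive $n$-homogeneous polynomial if $P(x)=A(x,\dots,x)$ for a symmetric $n$-linear form $A\colon E^n\to\mathbb R$ with $A(x_1,\dots,x_n)\ge 0$ whenever $x_1,\dots,x_n\ge 0$; a regular $n$-homogeneous polynomial is a difference of two positive $n$-homogeneous polynomials. Call $E$ a PPS lattice (a Banach lattice with the positive polynomial Schur property) if every sequence $(x_j)_{j=1}^\infty$ of positive vectors of $E$ such that $P(x_j)\to 0$ for every $n\ge 1$ and every regular $n$-homogeneous polynomial $P$ on $E$ satisfies $\|x_j\|\to 0$. Every PPS lattice $E$ is a KB-space, i.e. every increasing norm bounded sequence of positive vectors of $E$ is norm convergent. Consequently, every PPS lattice $E$ has order continuous norm (if a net $(x_\alpha)$ in $E$ decreases to $0$ in order, then $\|x_\alpha\|\to 0$), is weakly sequentially complete (every weakly Cauchy sequence in $E$ converges weakly), and is Dedekind complete (every nonempty subset of $E$ that is bounded above has a supremum). -/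

import Mathlib

open Filter Topology

universe u

/-- A function `P : E → ℝ` is a positive `n`-homogeneous polynomial if `P x = A (x, …, x)` for a
symmetric `n`-linear form `A` on `E` (unique, by polarization) which is nonnegative at tuples of
positive vectors. -/
def IsPositiveHomogeneousPolynomial {E : Type u} [NormedAddCommGroup E] [NormedSpace ℝ E]
    [Lattice E] (n : ℕ) (P : E → ℝ) : Prop :=
  ∃ A : MultilinearMap ℝ (fun _ : Fin n => E) ℝ,
    (∀ (σ : Equiv.Perm (Fin n)) (v : Fin n → E), A (fun i => v (σ i)) = A v) ∧
    (∀ v : Fin n → E, (∀ i, 0 ≤ v i) → 0 ≤ A v) ∧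
    ∀ x : E, P x = A (fun _ => x)

/-- A regular `n`-homogeneous polynomial is a difference of two positive ones. -/
def IsRegularHomogeneousPolynomial {E : Type u} [NormedAddCommGroup E] [NormedSpace ℝ E]
    [Lattice E] (n : ℕ) (P : E → ℝ) : Prop :=
  ∃ P₁ P₂ : E → ℝ, IsPositiveHomogeneousPolynomial n P₁ ∧
    IsPositiveHomogeneousPolynomial n P₂ ∧ P = P₁ - P₂

/-- The positive polynomial Schur property: a sequence of positive vectors that is sent to a null
sequence by every regular homogeneous polynomial is norm null. The degree `n` ranges over the
positive integers, so the nonzero constants are not among the test polynomials. -/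
def IsPPSLattice (E : Type u) [NormedAddCommGroup E] [NormedSpace ℝ E] [Lattice E] : Prop :=
  ∀ x : ℕ → E, (∀ j, 0 ≤ x j) →
    (∀ n : ℕ, 1 ≤ n → ∀ P : E → ℝ, IsRegularHomogeneousPolynomial n P →
      Tendsto (fun j => P (x j)) atTop (𝓝 0)) →
    Tendsto x atTop (𝓝 0)

/-- KB-space: every increasing norm bounded sequence of positive vectors converges in norm. -/
def IsKBSpace (E : Type u) [NormedAddCommGroup E] [Lattice E] : Prop :=
  ∀ x : ℕ → E, Monotone x → (∀ j, 0 ≤ x j) → (∃ C : ℝ, ∀ j, ‖x j‖ ≤ C) →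
    ∃ a : E, Tendsto x atTop (𝓝 a)

/-- Order continuity of the norm: if a net decreases to `0` in order, then its norms tend to `0`.
Index sets in the universe of `E` suffice, as a decreasing net can be indexed by its range. -/
def HasOrderContinuousNorm (E : Type u) [NormedAddCommGroup E] [Lattice E] : Prop :=
  ∀ (ι : Type u) [Preorder ι] [Nonempty ι] [IsDirectedOrder ι] (x : ι → E),
    Antitone x → IsGLB (Set.range x) 0 → Tendsto (fun i => ‖x i‖) atTop (𝓝 0)

/-- Weak sequential completeness: every weakly Cauchy sequence converges weakly. -/
def IsWeaklySequentiallyComplete (E : Type u) [NormedAddCommGroup E] [NormedSpace ℝ E] : Prop :=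
  ∀ x : ℕ → E, (∀ f : E →L[ℝ] ℝ, CauchySeq (fun j => f (x j))) →
    ∃ a : E, Tendsto (fun j => toWeakSpace ℝ E (x j)) atTop (𝓝 (toWeakSpace ℝ E a))

/-- Dedekind completeness: every nonempty set that is bounded above has a supremum. -/
def IsDedekindComplete (E : Type u) [Lattice E] : Prop :=
  ∀ S : Set E, S.Nonempty → BddAbove S → ∃ a : E, IsLUB S a

/-! ### Positive polynomials and the KB property -/

section PositivePolynomials

variable {E : Type u} [NormedAddCommGroup E] [NormedSpace ℝ E] [Lattice E]

/-! A positive polynomial of degree at least 1 is superadditive on the positive cone (`add_le`) and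
bounded on bounded positive sequences (`exists_bound`). An increasing bounded sequence that is not
Cauchy has increments `x j ≥ 0` along a subsequence, of norm at least `ε`, whose partial sums are
bounded. Then `∑ P (x j)` has bounded partial sums, so `P (x j) → 0` for every regular `P`, against
the PPS property. Hence the space is KB; the other claims hold in every KB-space.

The KB property passes from sequences to bounded monotone nets, whose norm limits are their suprema
or infima. This gives order continuity and Dedekind completeness.

For weak sequential completeness, Baire's theorem on the weak* compact interval `[0, f]` shows that
a weakly Cauchy sequence is uniformly integrable against each positive `f`. It therefore suffices to
find weak limits, along an ultrafilter, of the truncations by a fixed `v`. For one positive `F`,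
convex combinations almost minimizing a strictly convex energy are Cauchy for `F |·|`, and order
intervals of a KB-space are complete for this seminorm. The least such limit increases with `F`, and
the supremum over all `F` serves every functional. Letting `v` grow gives the weak limit. -/

theorem IsPositiveHomogeneousPolynomial.nonneg {n : ℕ} {P : E → ℝ}
    (hP : IsPositiveHomogeneousPolynomial n P) {x : E} (hx : 0 ≤ x) : 0 ≤ P x := by
  obtain ⟨A, -, hA, hPA⟩ := hP
  rw [hPA]
  exact hA _ fun _ => hx

theorem IsPositiveHomogeneousPolynomial.map_smul {n : ℕ} {P : E → ℝ}
    (hP : IsPositiveHomogeneousPolynomial n P) (c : ℝ) (x : E) : P (c • x) = c ^ n * P x := by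
  obtain ⟨A, -, -, hPA⟩ := hP
  rw [hPA, hPA]
  simpa using A.map_smul_univ (fun _ => c) (fun _ => x)

theorem IsPositiveHomogeneousPolynomial.add_le {n : ℕ} (hn : 1 ≤ n) {P : E → ℝ}
    (hP : IsPositiveHomogeneousPolynomial n P) {x y : E} (hx : 0 ≤ x) (hy : 0 ≤ y) :
    P x + P y ≤ P (x + y) := by
  obtain ⟨A, -, hA, hPA⟩ := hP
  have key := A.map_add_univ (fun _ => x) (fun _ => y)
  -- Here `1 ≤ n` matters: the two pure terms of the expansion must be different terms.
  have hne : (Finset.univ : Finset (Fin n)) ≠ ∅ := by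
    have : Nonempty (Fin n) := ⟨⟨0, hn⟩⟩
    exact Finset.univ_nonempty.ne_empty
  have hsum : ∑ s ∈ ({Finset.univ, ∅} : Finset (Finset (Fin n))),
      A (s.piecewise (fun _ => x) (fun _ => y)) ≤
      ∑ s : Finset (Fin n), A (s.piecewise (fun _ => x) (fun _ => y)) := by
    refine Finset.sum_le_sum_of_subset_of_nonneg (Finset.subset_univ _) fun s _ _ => ?_
    refine hA _ fun i => ?_
    by_cases hi : i ∈ s <;> simp [hi, hx, hy]
  rw [Finset.sum_pair hne] at hsum
  rw [hPA, hPA, hPA]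
  have : (fun _ : Fin n => x + y) = (fun _ => x) + fun _ => y := rfl
  rw [this, key]
  simpa using hsum

variable [IsOrderedAddMonoid E]

theorem IsPositiveHomogeneousPolynomial.mono {n : ℕ} (hn : 1 ≤ n) {P : E → ℝ}
    (hP : IsPositiveHomogeneousPolynomial n P) {x y : E} (hx : 0 ≤ x) (hxy : x ≤ y) :
    P x ≤ P y := by
  have h := hP.add_le hn hx (sub_nonneg.2 hxy)
  have h0 := hP.nonneg (sub_nonneg.2 hxy)
  rw [add_sub_cancel] at h
  linarith

theorem IsPositiveHomogeneousPolynomial.sum_le {n : ℕ} (hn : 1 ≤ n) {P : E → ℝ}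
    (hP : IsPositiveHomogeneousPolynomial n P) {x : ℕ → E} (hx : ∀ j, 0 ≤ x j) (m : ℕ) :
    ∑ j ∈ Finset.range m, P (x j) ≤ P (∑ j ∈ Finset.range m, x j) := by
  induction m with
  | zero => simpa using hP.nonneg le_rfl
  | succ m ih =>
    rw [Finset.sum_range_succ, Finset.sum_range_succ]
    have := hP.add_le hn (Finset.sum_nonneg fun j (_ : j ∈ Finset.range m) => hx j) (hx m)
    linarith

variable [IsOrderedModule ℝ E] [HasSolidNorm E] [CompleteSpace E]

/-- Positive polynomials are bounded on norm bounded sequences of positive vectors. -/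
theorem IsPositiveHomogeneousPolynomial.exists_bound {n : ℕ} (hn : 1 ≤ n) {P : E → ℝ}
    (hP : IsPositiveHomogeneousPolynomial n P) {x : ℕ → E} (hx : ∀ j, 0 ≤ x j) {C : ℝ}
    (hC : ∀ j, ‖x j‖ ≤ C) : ∃ M, ∀ j, P (x j) ≤ M := by
  by_contra! h
  -- The factor `2 ^ (j * n)` cancels the homogeneity factor of `(1 / 2) ^ j`, so the `j`-th term of
  -- the convergent series below still has `P`-value above `j`. By monotonicity `P` of the sum would
  -- exceed every `j`.
  choose k hk using fun j : ℕ => h ((2 : ℝ) ^ (j * n) * j)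
  have hs : Summable fun j : ℕ => (1 / 2 : ℝ) ^ j • x (k j) := by
    refine Summable.of_norm_bounded (g := fun j : ℕ => (1 / 2 : ℝ) ^ j * C)
      (summable_geometric_two.mul_right C) fun j => ?_
    rw [norm_smul, Real.norm_of_nonneg (by positivity)]
    gcongr
    exact hC _
  have hpos : ∀ j : ℕ, 0 ≤ (1 / 2 : ℝ) ^ j • x (k j) := fun j =>
    smul_nonneg (by positivity) (hx _)
  obtain ⟨j, hj⟩ := exists_nat_gt (P (∑' j : ℕ, (1 / 2 : ℝ) ^ j • x (k j)))
  have h1 := hP.mono hn (hpos j) (hs.le_tsum j fun i _ => hpos i)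
  rw [hP.map_smul] at h1
  have h2 : (j : ℝ) ≤ ((1 / 2 : ℝ) ^ j) ^ n * P (x (k j)) := by
    calc (j : ℝ) = ((1 / 2 : ℝ) ^ j) ^ n * (2 ^ (j * n) * j) := by
          rw [← pow_mul, ← mul_assoc, ← mul_pow]
          norm_num
      _ ≤ _ := by gcongr; exact (hk j).le
  linarith

theorem IsPositiveHomogeneousPolynomial.tendsto_zero {n : ℕ} (hn : 1 ≤ n) {P : E → ℝ}
    (hP : IsPositiveHomogeneousPolynomial n P) {x : ℕ → E} (hx : ∀ j, 0 ≤ x j) {C : ℝ}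
    (hC : ∀ m, ‖∑ j ∈ Finset.range m, x j‖ ≤ C) : Tendsto (fun j => P (x j)) atTop (𝓝 0) := by
  obtain ⟨M, hM⟩ := hP.exists_bound hn
    (fun m => Finset.sum_nonneg fun j (_ : j ∈ Finset.range m) => hx j) hC
  exact (summable_of_sum_range_le (fun j => hP.nonneg (hx j))
    fun m => (hP.sum_le hn hx m).trans (hM m)).tendsto_atTop_zero

theorem IsPPSLattice.isKBSpace (hE : IsPPSLattice E) : IsKBSpace E := by
  rintro y hy hy0 ⟨C, hC⟩
  refine cauchySeq_tendsto_of_complete ?_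
  rw [Metric.cauchySeq_iff']
  by_contra! h
  obtain ⟨ε, hε, h⟩ := h
  choose s hs hsε using h
  -- Iterating the choice of a far term yields successive jumps of norm at least `ε`.
  let k : ℕ → ℕ := fun j => s^[j] 0
  have hk : ∀ j, k (j + 1) = s (k j) := fun j => Function.iterate_succ_apply' s j 0
  let x : ℕ → E := fun j => y (k (j + 1)) - y (k j)
  have hx : ∀ j, 0 ≤ x j := fun j => sub_nonneg.2 (hy (by rw [hk]; exact hs _))
  have hlim : Tendsto x atTop (𝓝 0) := by
    refine hE x hx fun n hn P hP => ?_
    obtain ⟨P₁, P₂, h₁, h₂, rfl⟩ := hP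
    have hb : ∀ m, ‖∑ j ∈ Finset.range m, x j‖ ≤ C + C := fun m => by
      rw [Finset.sum_range_sub fun j => y (k j)]
      exact (norm_sub_le _ _).trans (add_le_add (hC _) (hC _))
    simpa using (h₁.tendsto_zero hn hx hb).sub (h₂.tendsto_zero hn hx hb)
  obtain ⟨N, hN⟩ := (Metric.tendsto_atTop.1 hlim) ε hε
  have h1 := hN N le_rfl
  rw [dist_zero_right] at h1
  have h2 := hsε (k N)
  rw [dist_eq_norm, ← hk] at h2
  exact absurd h1 (not_lt.2 h2)

end PositivePolynomials

/-! ### Monotone nets in KB-spaces -/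

section KBSpaces

variable {E : Type u} [NormedAddCommGroup E] [Lattice E] [IsOrderedAddMonoid E]

theorem posPart_add_le (x y : E) : (x + y)⁺ ≤ x⁺ + y⁺ :=
  sup_le (add_le_add (le_posPart x) (le_posPart y))
    (add_nonneg (posPart_nonneg x) (posPart_nonneg y))

theorem posPart_le_abs (x : E) : x⁺ ≤ |x| :=
  sup_le (le_abs_self x) (abs_nonneg x)

/-- In a KB-space, norm bounded increasing nets converge in norm. -/
theorem IsKBSpace.exists_tendsto [CompleteSpace E] (hE : IsKBSpace E) {ι : Type*} [Preorder ι]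
    [Nonempty ι] [IsDirectedOrder ι] {x : ι → E} (hx : Monotone x) {C : ℝ}
    (hC : ∀ i, ‖x i‖ ≤ C) :
    ∃ a, Tendsto x atTop (𝓝 a) := by
  refine CompleteSpace.complete ?_
  have key : ∀ ε > 0, ∃ i, ∀ j, i ≤ j → dist (x j) (x i) < ε := by
    by_contra! h
    obtain ⟨ε, hε, h⟩ := h
    choose s hs hsε using h
    obtain ⟨i₀⟩ := ‹Nonempty ι›
    let k : ℕ → ι := fun j => s^[j] i₀
    have hk : ∀ j, k (j + 1) = s (k j) := fun j => Function.iterate_succ_apply' s j i₀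
    have hmono : Monotone fun j => x (k j) :=
      monotone_nat_of_le_succ fun j => hx (by rw [hk]; exact hs _)
    -- Subtracting `x i₀` makes the sequence positive without changing its jumps.
    obtain ⟨a, ha⟩ := hE (fun j => x (k j) - x i₀)
      (fun i j hij => sub_le_sub_right (hmono hij) _)
      (fun j => sub_nonneg.2 (hmono (Nat.zero_le j)))
      ⟨C + C, fun j => (norm_sub_le _ _).trans (add_le_add (hC _) (hC _))⟩
    obtain ⟨N, hN⟩ := Metric.cauchySeq_iff.1 ha.cauchySeq ε hε
    have h1 := hN (N + 1) (Nat.le_succ N) N le_rfl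
    have h2 := hsε (k N)
    rw [← hk] at h2
    rw [dist_eq_norm, sub_sub_sub_cancel_right, ← dist_eq_norm] at h1
    exact absurd h1 (not_lt.2 h2)
  refine Metric.cauchy_iff.2 ⟨inferInstance, fun ε hε => ?_⟩
  obtain ⟨i, hi⟩ := key (ε / 2) (half_pos hε)
  refine ⟨x '' Set.Ici i, image_mem_map (mem_atTop i), ?_⟩
  rintro _ ⟨j, hj, rfl⟩ _ ⟨k, hk, rfl⟩
  have := dist_triangle_right (x j) (x k) (x i)
  linarith [hi j hj, hi k hk]

variable [HasSolidNorm E]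

theorem norm_le_norm_of_nonneg_of_le {x y : E} (hx : 0 ≤ x) (hxy : x ≤ y) : ‖x‖ ≤ ‖y‖ := by
  refine norm_le_norm_of_abs_le_abs ?_
  rwa [abs_of_nonneg hx, abs_of_nonneg (hx.trans hxy)]

theorem norm_posPart_le (x : E) : ‖x⁺‖ ≤ ‖x‖ := by
  rw [← norm_abs_eq_norm x]
  exact norm_le_norm_of_nonneg_of_le (posPart_nonneg x) (posPart_le_abs x)

variable [CompleteSpace E]

/-- Beyond any index `i₀` the net lies in `[0, x i₀]`, so its negative is increasing and norm
bounded there. -/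
theorem IsKBSpace.exists_tendsto_of_antitone (hE : IsKBSpace E) {ι : Type*} [Preorder ι]
    [Nonempty ι] [IsDirectedOrder ι] {x : ι → E} (hx : Antitone x) (h0 : ∀ i, 0 ≤ x i) :
    ∃ a, Tendsto x atTop (𝓝 a) := by
  obtain ⟨i₀⟩ := id ‹Nonempty ι›
  obtain ⟨j, hj⟩ : ∃ a, Tendsto (fun i : Set.Ici i₀ => -x i) atTop (𝓝 a) := by
    have : IsDirectedOrder (Set.Ici i₀) := ⟨fun a b => by
      obtain ⟨c, hac, hbc⟩ := exists_ge_ge a.1 b.1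
      exact ⟨⟨c, le_trans a.2 hac⟩, hac, hbc⟩⟩
    have : Nonempty (Set.Ici i₀) := ⟨⟨i₀, le_rfl⟩⟩
    refine hE.exists_tendsto (fun a b hab => neg_le_neg (hx hab)) (C := ‖x i₀‖) fun i => ?_
    rw [norm_neg]
    exact norm_le_norm_of_nonneg_of_le (h0 _) (hx i.2)
  refine ⟨-j, ?_⟩
  have h := hj.neg
  simp only [neg_neg] at h
  exact (tendsto_comp_val_Ici_atTop (f := x) (a := i₀)).1 h

/-- In a KB-space, an upward directed norm bounded set converges in norm to its supremum. -/
theorem IsKBSpace.exists_isLUB_tendsto (hE : IsKBSpace E) {S : Set E} (hS : S.Nonempty)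
    (hdir : DirectedOn (· ≤ ·) S) {C : ℝ} (hC : ∀ x ∈ S, ‖x‖ ≤ C) :
    ∃ a, IsLUB S a ∧ Tendsto ((↑) : S → E) atTop (𝓝 a) := by
  have : IsDirectedOrder S := ⟨directedOn_iff_directed.1 hdir⟩
  have : Nonempty S := hS.to_subtype
  obtain ⟨a, ha⟩ := hE.exists_tendsto (x := ((↑) : S → E)) (fun _ _ h => h)
    (fun x => hC x x.2)
  refine ⟨a, ?_, ha⟩
  have h := isLUB_of_tendsto_atTop (f := ((↑) : S → E)) (fun _ _ h => h) ha
  rwa [Subtype.range_coe] at h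

theorem IsKBSpace.hasOrderContinuousNorm (hE : IsKBSpace E) : HasOrderContinuousNorm E := by
  intro ι _ _ _ x hx h0
  obtain ⟨a, ha⟩ := hE.exists_tendsto_of_antitone hx fun i => h0.1 ⟨i, rfl⟩
  have : a = 0 := (isGLB_of_tendsto_atTop hx ha).unique h0
  simpa [this] using ha.norm

theorem IsKBSpace.isDedekindComplete (hE : IsKBSpace E) : IsDedekindComplete E := by
  rintro S ⟨s, hs⟩ ⟨b, hb⟩
  -- `T` is closed under binary suprema and has the same upper bounds as `S`; the lower bound `s`
  -- makes it norm bounded.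
  let T : Set E := {x | s ≤ x ∧ x ∈ lowerBounds (upperBounds S)}
  have hTb : ∀ x ∈ T, x ≤ b := fun x hx => hx.2 hb
  obtain ⟨a, ha, -⟩ := hE.exists_isLUB_tendsto (S := T) ⟨s, le_rfl, fun c hc => hc hs⟩
    (fun x hx y hy => ⟨x ⊔ y, ⟨hx.1.trans le_sup_left, fun c hc => sup_le (hx.2 hc) (hy.2 hc)⟩,
      le_sup_left, le_sup_right⟩) (C := ‖b - s‖ + ‖s‖) fun x hx => by
        have h1 := norm_le_norm_of_nonneg_of_le (sub_nonneg.2 hx.1)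
          (sub_le_sub_right (hTb x hx) s)
        have h2 := norm_add_le (x - s) s
        rw [sub_add_cancel] at h2
        linarith
  refine ⟨a, fun x hx => ?_, fun c hc => ha.2 fun x hx => hx.2 hc⟩
  have hsx : x ⊔ s ∈ T := ⟨le_sup_right, fun c hc => sup_le (hc hx) (hc hs)⟩
  exact le_sup_left.trans (ha.1 hsx)

end KBSpaces

/-! ### Positive functionals: positive parts, extension and separation -/

section PositiveFunctionals

variable {E : Type u} [NormedAddCommGroup E] [NormedSpace ℝ E] [Lattice E]

/-- A continuous linear functional that is nonnegative on the positive cone. -/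
def IsPositiveFunctional (f : E →L[ℝ] ℝ) : Prop :=
  ∀ x, 0 ≤ x → 0 ≤ f x

theorem isPositiveFunctional_zero : IsPositiveFunctional (0 : E →L[ℝ] ℝ) :=
  fun _ _ => le_rfl

theorem IsPositiveFunctional.add {f g : E →L[ℝ] ℝ} (hf : IsPositiveFunctional f)
    (hg : IsPositiveFunctional g) : IsPositiveFunctional (f + g) :=
  fun x hx => add_nonneg (hf x hx) (hg x hx)

theorem IsPositiveFunctional.apply_le_of_sub {f g : E →L[ℝ] ℝ} (h : IsPositiveFunctional (f - g))
    {x : E} (hx : 0 ≤ x) : g x ≤ f x :=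
  sub_nonneg.1 (h x hx)

variable [IsOrderedAddMonoid E]

theorem IsPositiveFunctional.mono {f : E →L[ℝ] ℝ} (hf : IsPositiveFunctional f) {x y : E}
    (hxy : x ≤ y) : f x ≤ f y := by
  have := hf _ (sub_nonneg.2 hxy)
  rw [map_sub] at this
  linarith

theorem IsPositiveFunctional.abs_apply_le {f : E →L[ℝ] ℝ} (hf : IsPositiveFunctional f) (x : E) :
    |f x| ≤ f |x| := by
  refine abs_le'.2 ⟨hf.mono (le_abs_self x), ?_⟩
  rw [← map_neg]
  exact hf.mono (neg_le_abs x)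

variable [IsOrderedModule ℝ E]

omit [IsOrderedAddMonoid E] in
theorem posPart_smul_of_nonneg {c : ℝ} (hc : 0 ≤ c) (x : E) : (c • x)⁺ = c • x⁺ := by
  rcases hc.eq_or_lt with rfl | hc
  · simp
  refine le_antisymm (sup_le (smul_le_smul_of_nonneg_left (le_posPart x) hc.le)
    (smul_nonneg hc.le (posPart_nonneg x))) ?_
  have h : x⁺ ≤ c⁻¹ • (c • x)⁺ := by
    refine sup_le ?_ (smul_nonneg (inv_nonneg.2 hc.le) (posPart_nonneg _))
    have := smul_le_smul_of_nonneg_left (le_posPart (c • x)) (inv_nonneg.2 hc.le)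
    rwa [inv_smul_smul₀ hc.ne'] at this
  have := smul_le_smul_of_nonneg_left h hc.le
  rwa [smul_inv_smul₀ hc.ne'] at this

/-- An additive, positively homogeneous function on the positive cone extends linearly. -/
theorem exists_linearMap_of_additive_on_cone (p : E → ℝ)
    (hadd : ∀ x y, 0 ≤ x → 0 ≤ y → p (x + y) = p x + p y)
    (hsmul : ∀ c : ℝ, 0 ≤ c → ∀ x, 0 ≤ x → p (c • x) = c * p x) :
    ∃ l : E →ₗ[ℝ] ℝ, ∀ x, 0 ≤ x → l x = p x := by
  have hdiff : ∀ a b c d : E, 0 ≤ a → 0 ≤ b → 0 ≤ c → 0 ≤ d → a - b = c - d →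
      p a - p b = p c - p d := by
    intro a b c d ha hb hc hd h
    have h1 : a + d = c + b := by rw [sub_eq_sub_iff_add_eq_add] at h; exact h
    have h2 := hadd a d ha hd
    rw [h1, hadd c b hc hb] at h2
    linarith
  have hp0 : p 0 = 0 := by simpa using hsmul 0 le_rfl 0 le_rfl
  have hval : ∀ a b x : E, 0 ≤ a → 0 ≤ b → x = a - b → p x⁺ - p x⁻ = p a - p b :=
    fun a b x ha hb h => hdiff _ _ _ _ (posPart_nonneg _) (negPart_nonneg _) ha hb
      (by rw [posPart_sub_negPart, h])
  refine ⟨⟨⟨fun x => p x⁺ - p x⁻, fun x y => ?_⟩, fun c x => ?_⟩, fun x hx => ?_⟩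
  · rw [hval (x⁺ + y⁺) (x⁻ + y⁻) (x + y) (add_nonneg (posPart_nonneg _) (posPart_nonneg _))
      (add_nonneg (negPart_nonneg _) (negPart_nonneg _)) (by
        rw [add_sub_add_comm, posPart_sub_negPart, posPart_sub_negPart]),
      hadd _ _ (posPart_nonneg _) (posPart_nonneg _),
      hadd _ _ (negPart_nonneg _) (negPart_nonneg _)]
    ring
  · dsimp only [RingHom.id_apply, smul_eq_mul]
    rcases le_total 0 c with hc | hc
    · rw [hval (c • x⁺) (c • x⁻) (c • x) (smul_nonneg hc (posPart_nonneg _))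
        (smul_nonneg hc (negPart_nonneg _)) (by rw [← smul_sub, posPart_sub_negPart]),
        hsmul _ hc _ (posPart_nonneg _), hsmul _ hc _ (negPart_nonneg _)]
      ring
    · have hc' : 0 ≤ -c := neg_nonneg.2 hc
      rw [hval (-c • x⁻) (-c • x⁺) (c • x) (smul_nonneg hc' (negPart_nonneg _))
        (smul_nonneg hc' (posPart_nonneg _)) (by
          rw [← smul_sub, ← neg_sub, posPart_sub_negPart, smul_neg, neg_smul, neg_neg]),
        hsmul _ hc' _ (posPart_nonneg _), hsmul _ hc' _ (negPart_nonneg _)]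
      ring
  · simpa [hp0] using hval x 0 x hx le_rfl (sub_zero x).symm

variable [HasSolidNorm E]

omit [IsOrderedModule ℝ E] in
/-- A linear functional that is nonnegative and bounded on the positive cone is continuous. -/
theorem exists_continuousLinearMap_of_bound (l : E →ₗ[ℝ] ℝ) (C : ℝ) (h0 : ∀ x, 0 ≤ x → 0 ≤ l x)
    (hC : ∀ x, 0 ≤ x → l x ≤ C * ‖x‖) : ∃ g : E →L[ℝ] ℝ, ∀ x, g x = l x := by
  refine ⟨l.mkContinuous C fun x => ?_, fun x => rfl⟩
  have h1 := h0 _ (sub_nonneg.2 (le_abs_self x))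
  have h2 := h0 _ (neg_le_iff_add_nonneg.1 (neg_le_abs x))
  have h3 := hC _ (abs_nonneg x)
  rw [norm_abs_eq_norm] at h3
  rw [map_sub] at h1
  rw [map_add] at h2
  exact abs_le.2 ⟨by linarith, by linarith⟩

/-- The positive part of a continuous linear functional. -/
theorem exists_posPart_functional (h : E →L[ℝ] ℝ) :
    ∃ p : E →L[ℝ] ℝ, IsPositiveFunctional p ∧ IsPositiveFunctional (p - h) ∧
      ∀ q : E →L[ℝ] ℝ, IsPositiveFunctional q → IsPositiveFunctional (q - h) →
        IsPositiveFunctional (q - p) := by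
  -- The Riesz–Kantorovich formula.
  let p : E → ℝ := fun x => sSup (h '' Set.Icc 0 x)
  have hbound : ∀ x : E, 0 ≤ x → ∀ z ∈ Set.Icc 0 x, h z ≤ ‖h‖ * ‖x‖ := fun x _ z hz =>
    (le_abs_self _).trans ((h.le_opNorm z).trans
      (by gcongr; exact norm_le_norm_of_nonneg_of_le hz.1 hz.2))
  have hlub : ∀ x : E, 0 ≤ x → IsLUB (h '' Set.Icc 0 x) (p x) := fun x hx =>
    isLUB_csSup (Set.Nonempty.image _ ⟨0, le_rfl, hx⟩)
      ⟨‖h‖ * ‖x‖, Set.forall_mem_image.2 (hbound x hx)⟩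
  have hle : ∀ x z : E, 0 ≤ z → z ≤ x → h z ≤ p x := fun x z hz hzx =>
    (hlub x (hz.trans hzx)).1 ⟨z, ⟨hz, hzx⟩, rfl⟩
  have hge : ∀ x : E, 0 ≤ x → ∀ b, (∀ z, 0 ≤ z → z ≤ x → h z ≤ b) → p x ≤ b := fun x hx b hb =>
    (hlub x hx).2 (Set.forall_mem_image.2 fun z hz => hb z hz.1 hz.2)
  have hadd : ∀ x y, 0 ≤ x → 0 ≤ y → p (x + y) = p x + p y := by
    intro x y hx hy
    refine le_antisymm (hge _ (add_nonneg hx hy) _ fun z hz hzxy => ?_) ?_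
    -- Riesz decomposition: `z ≤ x + y` splits into `z ⊓ x ≤ x` and `z - z ⊓ x ≤ y`.
    · have h1 := hle x (z ⊓ x) (le_inf hz hx) inf_le_right
      have h2 := hle y (z - z ⊓ x) (sub_nonneg.2 inf_le_left) (by
        rw [sub_le_iff_le_add, add_inf]
        exact le_inf (le_add_of_nonneg_left hy) (by rwa [add_comm]))
      rw [map_sub] at h2
      linarith
    · rw [← le_sub_iff_add_le]
      refine hge _ hx _ fun z hz hzx => ?_
      rw [le_sub_comm]
      refine hge _ hy _ fun w hw hwy => ?_
      have := hle (x + y) (z + w) (add_nonneg hz hw) (add_le_add hzx hwy)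
      rw [map_add] at this
      linarith
  have hsmul' : ∀ c : ℝ, 0 < c → ∀ x, 0 ≤ x → c * p x ≤ p (c • x) := by
    intro c hc x hx
    rw [← le_div_iff₀' hc]
    refine hge _ hx _ fun z hz hzx => ?_
    rw [le_div_iff₀' hc]
    have := hle (c • x) (c • z) (smul_nonneg hc.le hz) (smul_le_smul_of_nonneg_left hzx hc.le)
    rwa [map_smul] at this
  have hp0 : p 0 = 0 := by
    have := hadd 0 0 le_rfl le_rfl
    rw [add_zero] at this
    linarith
  have hsmul : ∀ c : ℝ, 0 ≤ c → ∀ x, 0 ≤ x → p (c • x) = c * p x := by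
    intro c hc x hx
    rcases hc.eq_or_lt with rfl | hc
    · simp [hp0]
    refine le_antisymm ?_ (hsmul' c hc x hx)
    have := hsmul' c⁻¹ (inv_pos.2 hc) (c • x) (smul_nonneg hc.le hx)
    rw [inv_smul_smul₀ hc.ne'] at this
    rwa [inv_mul_le_iff₀ hc] at this
  obtain ⟨l, hl⟩ := exists_linearMap_of_additive_on_cone p hadd hsmul
  have hp_nonneg : ∀ x, 0 ≤ x → 0 ≤ p x := fun x hx => by
    simpa using hle x 0 le_rfl hx
  obtain ⟨g, hg⟩ := exists_continuousLinearMap_of_bound l ‖h‖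
    (fun x hx => (hp_nonneg x hx).trans_eq (hl x hx).symm)
    (fun x hx => (hl x hx).trans_le (hge x hx _ fun z hz hzx => hbound x hx z ⟨hz, hzx⟩))
  have hgp : ∀ x, 0 ≤ x → g x = p x := fun x hx => (hg x).trans (hl x hx)
  refine ⟨g, fun x hx => ?_, fun x hx => ?_, fun q hq hqh x hx => ?_⟩
  · rw [hgp x hx]; exact hp_nonneg x hx
  · have := hle x x hx le_rfl
    rw [sub_apply, hgp x hx]
    linarith
  · rw [sub_apply, hgp x hx, sub_nonneg]
    exact hge x hx _ fun z hz hzx => (hqh.apply_le_of_sub hz).trans (hq.mono hzx)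

/-- Positive functionals dominated by `f` attain `f x⁺` at `x`. -/
theorem IsPositiveFunctional.exists_apply_eq_posPart {f : E →L[ℝ] ℝ}
    (hf : IsPositiveFunctional f) (z : E) :
    ∃ g : E →L[ℝ] ℝ, IsPositiveFunctional g ∧ IsPositiveFunctional (f - g) ∧ g z = f z⁺ := by
  rcases eq_or_ne z 0 with rfl | hz
  · exact ⟨0, isPositiveFunctional_zero, by simpa using hf, by simp⟩
  -- Hahn–Banach with the sublinear majorant `x ↦ f x⁺`, starting from the line through `z`.
  -- Domination by this majorant forces both `0 ≤ l` and `l ≤ f` on the cone.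
  obtain ⟨l, hl, hlf⟩ := exists_extension_of_le_sublinear
    (LinearPMap.mkSpanSingleton (σ := RingHom.id ℝ) z (f z⁺) hz) (fun x => f x⁺)
    (fun c hc x => by rw [posPart_smul_of_nonneg hc.le, map_smul, smul_eq_mul])
    (fun x y => by rw [← map_add]; exact hf.mono (posPart_add_le x y)) (by
      rintro ⟨x, hx⟩
      obtain ⟨c, rfl⟩ := Submodule.mem_span_singleton.1 hx
      rw [LinearPMap.mkSpanSingleton'_apply, RingHom.id_apply, smul_eq_mul]
      dsimp only
      rcases le_total 0 c with hc | hc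
      · rw [posPart_smul_of_nonneg hc, map_smul, smul_eq_mul]
      · exact (mul_nonpos_of_nonpos_of_nonneg hc (hf _ (posPart_nonneg _))).trans
          (hf _ (posPart_nonneg _)))
  have hl0 : ∀ x, 0 ≤ x → 0 ≤ l x := fun x hx => by
    have := hlf (-x)
    rw [posPart_eq_zero.2 (neg_nonpos.2 hx), map_zero, map_neg] at this
    linarith
  have hl1 : ∀ x, 0 ≤ x → l x ≤ f x := fun x hx => by
    have := hlf x
    rwa [posPart_of_nonneg hx] at this
  obtain ⟨g, hg⟩ := exists_continuousLinearMap_of_bound l ‖f‖ hl0 fun x hx =>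
    (hl1 x hx).trans ((le_abs_self _).trans (f.le_opNorm x))
  refine ⟨g, fun x hx => ?_, fun x hx => ?_, ?_⟩
  · rw [hg]; exact hl0 x hx
  · rw [sub_apply, hg, sub_nonneg]; exact hl1 x hx
  · rw [hg]
    have := hl ⟨z, Submodule.mem_span_singleton_self z⟩
    rwa [LinearPMap.mkSpanSingleton_apply] at this

/-- If `x⁻ ≠ 0`, some positive `p` has `p x⁻ > 0`, and a positive `g ≤ p` with `g (-x) = p x⁻` is
negative at `x`. -/
theorem nonneg_of_forall_isPositiveFunctional {x : E}
    (h : ∀ f : E →L[ℝ] ℝ, IsPositiveFunctional f → 0 ≤ f x) : 0 ≤ x := by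
  rw [← negPart_eq_zero]
  by_contra hne
  obtain ⟨f, -, hf⟩ := exists_dual_vector ℝ x⁻ (norm_ne_zero_iff.2 hne)
  obtain ⟨p, hp, hpf, -⟩ := exists_posPart_functional f
  have h1 : 0 < p x⁻ := by
    refine lt_of_lt_of_le ?_ (hpf.apply_le_of_sub (negPart_nonneg x))
    rw [hf]
    simpa using hne
  obtain ⟨g, hg, -, hgx⟩ := hp.exists_apply_eq_posPart (-x)
  have h2 := h g hg
  rw [posPart_neg, map_neg] at hgx
  linarith

/-- Every continuous functional is a difference of positive ones, so limits may be tested on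
positive functionals. -/
theorem tendsto_of_forall_isPositiveFunctional {ι : Type*} {l : Filter ι} {z : ι → E} {x : E}
    (h : ∀ f : E →L[ℝ] ℝ, IsPositiveFunctional f → Tendsto (fun i => f (z i)) l (𝓝 (f x)))
    (f : E →L[ℝ] ℝ) : Tendsto (fun i => f (z i)) l (𝓝 (f x)) := by
  obtain ⟨p, hp, hpf, -⟩ := exists_posPart_functional f
  simpa using (h p hp).sub (h _ hpf)

omit [Lattice E] [IsOrderedAddMonoid E] [IsOrderedModule ℝ E] [HasSolidNorm E] in
theorem norm_le_of_forall_apply_le {x : E} {C : ℝ} (hC : 0 ≤ C)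
    (h : ∀ f : E →L[ℝ] ℝ, f x ≤ ‖f‖ * C) : ‖x‖ ≤ C := by
  rcases eq_or_ne x 0 with rfl | hx
  · simpa
  obtain ⟨f, hf1, hf⟩ := exists_dual_vector ℝ x (norm_ne_zero_iff.2 hx)
  have := h f
  rw [hf, hf1, one_mul] at this
  simpa using this

end PositiveFunctionals

/-! ### Uniform integrability of weakly Cauchy sequences -/

section WeaklyCauchy

variable {E : Type u} [NormedAddCommGroup E] [NormedSpace ℝ E] [Lattice E]
  [IsOrderedAddMonoid E] [IsOrderedModule ℝ E] [HasSolidNorm E]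

omit [IsOrderedModule ℝ E] in
/-- The order interval `[0, f]` of functionals is compact for pointwise convergence. -/
theorem isCompact_functional_interval (f : E →L[ℝ] ℝ) :
    IsCompact {φ : E → ℝ | ∃ g : E →L[ℝ] ℝ, IsPositiveFunctional g ∧
      IsPositiveFunctional (f - g) ∧ ∀ x, φ x = g x} := by
  set K := {φ : E → ℝ | ∃ g : E →L[ℝ] ℝ, IsPositiveFunctional g ∧
      IsPositiveFunctional (f - g) ∧ ∀ x, φ x = g x} with hK
  have hsub : K ⊆ Set.pi Set.univ fun x => Set.Icc (-f |x|) (f |x|) := by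
    rintro φ ⟨g, hg, hfg, hφ⟩ x -
    rw [hφ]
    exact abs_le.1 ((hg.abs_apply_le x).trans (hfg.apply_le_of_sub (abs_nonneg x)))
  refine (isCompact_univ_pi fun x => isCompact_Icc).of_isClosed_subset ?_ hsub
  -- Membership amounts to closed pointwise conditions, since continuity is automatic from `0 ≤ φ ≤
  -- f` on the cone. Tychonoff then gives compactness.
  have heq : K = {φ | ∀ x y, φ (x + y) = φ x + φ y} ∩ {φ | ∀ (c : ℝ) x, φ (c • x) = c * φ x} ∩
      {φ | ∀ x, 0 ≤ x → 0 ≤ φ x ∧ φ x ≤ f x} := by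
    ext φ
    constructor
    · rintro ⟨g, hg, hfg, hφ⟩
      exact ⟨⟨fun x y => by simp [hφ], fun c x => by simp [hφ]⟩, fun x hx => by
        rw [hφ]; exact ⟨hg x hx, hfg.apply_le_of_sub hx⟩⟩
    · rintro ⟨⟨h1, h2⟩, h3⟩
      obtain ⟨g, hg⟩ := exists_continuousLinearMap_of_bound ⟨⟨φ, h1⟩, h2⟩ ‖f‖
        (fun x hx => (h3 x hx).1) (fun x hx => (h3 x hx).2.trans
          ((le_abs_self _).trans (f.le_opNorm x)))
      replace hg : ∀ x, g x = φ x := hg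
      refine ⟨g, fun x hx => ?_, fun x hx => ?_, fun x => (hg x).symm⟩
      · rw [hg]; exact (h3 x hx).1
      · rw [sub_apply, hg, sub_nonneg]; exact (h3 x hx).2
  rw [heq]
  refine (IsClosed.inter ?_ ?_).inter ?_
  · simp only [Set.ofPred_forall]
    exact isClosed_iInter fun x => isClosed_iInter fun y =>
      isClosed_eq (by fun_prop) (by fun_prop)
  · simp only [Set.ofPred_forall]
    exact isClosed_iInter fun x => isClosed_iInter fun y =>
      isClosed_eq (by fun_prop) (by fun_prop)
  · simp only [Set.ofPred_forall]
    refine isClosed_iInter fun x => isClosed_iInter fun hx => ?_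
    exact (isClosed_Icc (a := (0 : ℝ)) (b := f x)).preimage
      (continuous_apply x : Continuous fun φ : E → ℝ => φ x)

/-- Two functionals `g₀, g` in `[0, f]` admit `g₁, g₂` in `[0, f]` with `g₁ - g₂ = g` and both
within `g` of `g₀`. -/
theorem exists_sub_eq_of_le {f g₀ g : E →L[ℝ] ℝ} (hg₀ : IsPositiveFunctional g₀)
    (hfg₀ : IsPositiveFunctional (f - g₀)) (hg : IsPositiveFunctional g)
    (hfg : IsPositiveFunctional (f - g)) :
    ∃ g₂ : E →L[ℝ] ℝ, IsPositiveFunctional g₂ ∧ IsPositiveFunctional (g₀ - g₂) ∧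
      IsPositiveFunctional (f - (g₂ + g)) ∧ IsPositiveFunctional (g₂ + g - g₀) := by
  -- The functional `g₀ - p` is the infimum of `g₀` and `f - g`.
  obtain ⟨p, hp, hp1, hp2⟩ := exists_posPart_functional (g₀ - (f - g))
  refine ⟨g₀ - p, hp2 g₀ hg₀ (by rwa [sub_sub_cancel]), by rwa [sub_sub_cancel], ?_, ?_⟩
  · convert hp1 using 1
    abel
  · convert hp2 g hg (by convert hfg₀ using 1; abel) using 1
    abel

/-- A weakly Cauchy sequence is uniformly absolutely continuous on `[0, f]`. -/
theorem IsPositiveFunctional.exists_forall_abs_apply_sub_le {f : E →L[ℝ] ℝ}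
    (hf : IsPositiveFunctional f) {y : ℕ → E}
    (hy : ∀ g : E →L[ℝ] ℝ, CauchySeq fun j => g (y j)) {ε : ℝ} (hε : 0 < ε) :
    ∃ v : E, 0 ≤ v ∧ ∃ δ > 0, ∃ N : ℕ, ∀ g : E →L[ℝ] ℝ, IsPositiveFunctional g →
      IsPositiveFunctional (f - g) → g v < δ → ∀ n ≥ N, ∀ m ≥ N, |g (y n - y m)| ≤ ε := by
  set K := {φ : E → ℝ | ∃ g : E →L[ℝ] ℝ, IsPositiveFunctional g ∧
      IsPositiveFunctional (f - g) ∧ ∀ x, φ x = g x} with hK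
  have : CompactSpace K := isCompact_iff_compactSpace.1 (isCompact_functional_interval f)
  have : Nonempty K := ⟨⟨f, f, hf, by rw [sub_self]; exact isPositiveFunctional_zero, fun x => rfl⟩⟩
  let S : ℕ → Set K := fun N => {φ | ∀ n ≥ N, ∀ m ≥ N, |φ.1 (y n) - φ.1 (y m)| ≤ ε / 2}
  -- Baire on the compact space `K`: the closed sets `S N` cover it because each functional sends
  -- `y` to a Cauchy sequence.
  obtain ⟨N, φ₀, hφ₀⟩ := nonempty_interior_of_iUnion_of_closed (f := S) (fun N => by
    have heq : S N = ⋂ n ≥ N, ⋂ m ≥ N, {φ : K | |φ.1 (y n) - φ.1 (y m)| ≤ ε / 2} := by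
      ext φ; simp [S]
    rw [heq]
    exact isClosed_iInter fun n => isClosed_iInter fun _ => isClosed_iInter fun m =>
      isClosed_iInter fun _ => isClosed_le
        (((continuous_apply (y n)).comp continuous_subtype_val).sub
          ((continuous_apply (y m)).comp continuous_subtype_val)).abs continuous_const) (by
    refine Set.eq_univ_of_forall fun φ => ?_
    obtain ⟨g, -, -, hg⟩ := φ.2
    obtain ⟨N, hN⟩ := Metric.cauchySeq_iff.1 (hy g) (ε / 2) (half_pos hε)
    refine Set.mem_iUnion.2 ⟨N, fun n hn m hm => ?_⟩
    rw [hg, hg, ← Real.dist_eq]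
    exact (hN n hn m hm).le)
  obtain ⟨U, hUS, hUo, hφU⟩ := mem_interior.1 hφ₀
  obtain ⟨V, hVo, rfl⟩ := isOpen_induced_iff.1 hUo
  obtain ⟨I, u, hu, huV⟩ := isOpen_pi_iff.1 hVo φ₀ hφU
  have hball : ∀ x ∈ I, ∃ δ > 0, Metric.ball (φ₀.1 x) δ ⊆ u x := fun x hx =>
    Metric.isOpen_iff.1 (hu x hx).1 _ (hu x hx).2
  obtain ⟨δ, hδ, hδu⟩ : ∃ δ > 0, ∀ x ∈ I, Metric.ball (φ₀.1 x) δ ⊆ u x := by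
    have h : ∀ᶠ δ : ℝ in 𝓝[>] 0, ∀ x ∈ I, Metric.ball (φ₀.1 x) δ ⊆ u x := by
      rw [Filter.eventually_all_finset]
      intro x hx
      obtain ⟨δ, hδ, h⟩ := hball x hx
      filter_upwards [Ioo_mem_nhdsGT hδ] with δ' hδ'
      exact (Metric.ball_subset_ball hδ'.2.le).trans h
    obtain ⟨δ, h1, h2⟩ := (h.and self_mem_nhdsWithin).exists
    exact ⟨δ, h2, h1⟩
  -- A basic neighbourhood of `φ₀` constrains only the coordinates in `I`, and `g |x| ≤ g v < δ` for
  -- each of them. So `g₂` and `g₂ + g` both lie in it, and their difference `g` inherits the bound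
  -- `ε / 2 + ε / 2`.
  refine ⟨∑ x ∈ I, |x|, Finset.sum_nonneg fun x _ => abs_nonneg x, δ, hδ, N, ?_⟩
  intro g hg hfg hgv n hn m hm
  obtain ⟨g₀, hg₀, hfg₀, hφg⟩ := φ₀.2
  obtain ⟨g₂, h1, h2, h3, h4⟩ := exists_sub_eq_of_le hg₀ hfg₀ hg hfg
  have hmem : ∀ h : E →L[ℝ] ℝ, IsPositiveFunctional h → IsPositiveFunctional (f - h) →
      (∀ x, |h x - g₀ x| ≤ g |x|) → |h (y n) - h (y m)| ≤ ε / 2 := by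
    intro h hh hfh hhg
    refine hUS (a := (⟨h, h, hh, hfh, fun x => rfl⟩ : K)) (huV fun x hx => ?_) n hn m hm
    refine hδu x hx ?_
    rw [Metric.mem_ball, Real.dist_eq, hφg]
    refine (hhg x).trans_lt (lt_of_le_of_lt (hg.mono ?_) hgv)
    exact Finset.single_le_sum (f := fun x => |x|) (fun x _ => abs_nonneg x) hx
  have hd2 := hmem g₂ h1 (by convert h2.add hfg₀ using 1; abel) fun x => by
    rw [abs_sub_comm]
    refine (h2.abs_apply_le x).trans ?_
    have := h4 |x| (abs_nonneg x)
    simp only [sub_apply, add_apply] at this ⊢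
    linarith
  have hd1 := hmem (g₂ + g) (h1.add hg) h3 fun x => by
    refine (h4.abs_apply_le x).trans ?_
    have := h2 |x| (abs_nonneg x)
    simp only [sub_apply, add_apply] at this ⊢
    linarith
  simp only [add_apply] at hd1
  rw [map_sub]
  have := abs_le.1 hd1
  have := abs_le.1 hd2
  exact abs_le.2 ⟨by linarith, by linarith⟩

omit [Lattice E] [IsOrderedAddMonoid E] [IsOrderedModule ℝ E] [HasSolidNorm E] in
theorem exists_norm_le_of_weaklyCauchy {y : ℕ → E}
    (hy : ∀ g : E →L[ℝ] ℝ, CauchySeq fun j => g (y j)) : ∃ C, 0 ≤ C ∧ ∀ n, ‖y n‖ ≤ C := by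
  obtain ⟨C, hC⟩ := banach_steinhaus
    (g := fun n => NormedSpace.inclusionInDoubleDual ℝ E (y n)) fun g => by
      obtain ⟨C, hC⟩ := (hy g).isBounded_range.exists_norm_le
      exact ⟨C, fun n => by simpa using hC _ ⟨n, rfl⟩⟩
  have h : ∀ n, ‖y n‖ ≤ C := fun n => by
    simpa using (NormedSpace.inclusionInDoubleDualLi ℝ (E := E)).norm_map (y n) ▸ hC n
  exact ⟨C, (norm_nonneg _).trans (h 0), h⟩

/-- A weakly Cauchy sequence is uniformly integrable with respect to every positive functional. -/
theorem IsPositiveFunctional.exists_forall_apply_posPart_le {f : E →L[ℝ] ℝ}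
    (hf : IsPositiveFunctional f) {y : ℕ → E}
    (hy : ∀ g : E →L[ℝ] ℝ, CauchySeq fun j => g (y j)) {ε : ℝ} (hε : 0 < ε) :
    ∃ v : E, 0 ≤ v ∧ ∀ᶠ n in atTop, f (|y n| - v)⁺ ≤ ε := by
  obtain ⟨v₀, hv₀, δ, hδ, N, hN⟩ := hf.exists_forall_abs_apply_sub_le hy
    (show 0 < ε / 6 by positivity)
  obtain ⟨C, hC0, hC⟩ := exists_norm_le_of_weaklyCauchy hy
  have hv₁ : 0 ≤ v₀ + |y N| := add_nonneg hv₀ (abs_nonneg _)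
  -- If `g` attains `f (|y n| - k • w)⁺` with `w = v₀ + |y N|`, then `k * g w ≤ g |y n| ≤ ‖f‖ * C`.
  -- A large `k` thus makes `g w` small, and with it `g v₀` and `g |y N|`.
  obtain ⟨k, hk0, hk⟩ : ∃ k : ℝ, 0 < k ∧ ‖f‖ * C < k * min δ (ε / 6) := by
    have hm : 0 < min δ (ε / 6) := lt_min hδ (by positivity)
    refine ⟨(‖f‖ * C + 1) / min δ (ε / 6), by positivity, ?_⟩
    rw [div_mul_cancel₀ _ hm.ne']
    linarith
  refine ⟨k • (v₀ + |y N|), smul_nonneg hk0.le hv₁, ?_⟩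
  filter_upwards [eventually_ge_atTop N] with n hn
  obtain ⟨g, hg, hfg, hgz⟩ := hf.exists_apply_eq_posPart (|y n| - k • (v₀ + |y N|))
  have hgv : g (v₀ + |y N|) < min δ (ε / 6) := by
    have h1 := hf _ (posPart_nonneg (|y n| - k • (v₀ + |y N|)))
    rw [← hgz, map_sub, map_smul, smul_eq_mul] at h1
    have h2 : g |y n| ≤ ‖f‖ * C := (hfg.apply_le_of_sub (abs_nonneg _)).trans
      ((le_abs_self _).trans ((f.le_opNorm _).trans (by
        rw [norm_abs_eq_norm]; gcongr; exact hC n)))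
    exact lt_of_mul_lt_mul_left ((sub_nonneg.1 h1).trans h2 |>.trans_lt hk) hk0.le
  have hsmall : ∀ g' : E →L[ℝ] ℝ, IsPositiveFunctional g' → IsPositiveFunctional (g - g') →
      |g' (y n)| ≤ ε / 3 := by
    intro g' hg' hgg'
    have h1 : g' (v₀ + |y N|) < min δ (ε / 6) := (hgg'.apply_le_of_sub hv₁).trans_lt hgv
    have h0 := hg' v₀ hv₀
    have h0' := hg' _ (abs_nonneg (y N))
    rw [map_add] at h1
    have h2 := hN g' hg' (by convert hgg'.add hfg using 1; abel)
      (by linarith [min_le_left δ (ε / 6)]) n hn N le_rfl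
    have h3 : |g' (y N)| ≤ ε / 6 := (hg'.abs_apply_le _).trans
      (by linarith [min_le_right δ (ε / 6)])
    rw [map_sub] at h2
    have := abs_le.1 h2
    have := abs_le.1 h3
    exact abs_le.2 ⟨by linarith, by linarith⟩
  -- Since `g |y n| = 2 * g' (y n) - g (y n)`, smallness of functionals at `y n` controls the
  -- absolute value.
  obtain ⟨g', hg', hgg', hgy⟩ := hg.exists_apply_eq_posPart (y n)
  have h1 := abs_le.1 (hsmall g' hg' hgg')
  have h2 := abs_le.1 (hsmall g hg (by rw [sub_self]; exact isPositiveFunctional_zero))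
  have h3 : g |y n| = 2 * g (y n)⁺ - g (y n) := by
    have e1 : |y n| = (y n)⁺ + (y n)⁻ := (posPart_add_negPart _).symm
    have e2 : g (y n) = g (y n)⁺ - g (y n)⁻ := by rw [← map_sub, posPart_sub_negPart]
    rw [e1, map_add]
    linarith
  have h4 : 0 ≤ g (k • (v₀ + |y N|)) := hg _ (smul_nonneg hk0.le hv₁)
  rw [← hgz, map_sub]
  linarith

end WeaklyCauchy

/-! ### Lattice inequalities behind strict convexity -/

section LatticeInequalities

variable {E : Type u} [AddCommGroup E] [Lattice E] [IsOrderedAddMonoid E]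

/-- The convexity gap of the positive part sees how far `a` and `b` lie on opposite sides of `0`. -/
theorem posPart_inf_negPart_le (a b : E) : a⁺ ⊓ b⁻ ≤ a⁺ + b⁺ - (a + b)⁺ := by
  rw [le_sub_comm]
  refine sup_le ?_ (sub_nonneg.2 (inf_le_left.trans (le_add_of_nonneg_right (posPart_nonneg b))))
  calc a + b ≤ a⁺ + (b⁺ - b⁻) := by
        rw [posPart_sub_negPart]; exact add_le_add_left (le_posPart a) b
    _ = a⁺ + b⁺ - b⁻ := by abel
    _ ≤ _ := sub_le_sub_left inf_le_right _

theorem posPart_inf_sub_le_add (a s t y : E) :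
    (a ⊓ s - y)⁺ ≤ (a ⊓ t - y)⁺ + (a - t)⁺ ⊓ (s - y)⁺ := by
  have h0 : 0 ≤ (a ⊓ t - y)⁺ := posPart_nonneg _
  refine sup_le ?_ (add_nonneg h0 (le_inf (posPart_nonneg _) (posPart_nonneg _)))
  rw [add_inf]
  refine le_inf ?_ ?_
  · calc a ⊓ s - y ≤ a - y := sub_le_sub_right inf_le_left y
      _ = (a ⊓ t - y) + (a - t)⁺ := by rw [inf_eq_sub_posPart_sub]; abel
      _ ≤ _ := add_le_add_left (le_posPart _) _
  · exact (sub_le_sub_right inf_le_right y).trans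
      ((le_posPart _).trans (le_add_of_nonneg_left h0))

theorem posPart_inf_sub_le_sum (x : E) {y : E} (hy : 0 ≤ y) {t : ℕ → E}
    (ht0 : t 0 = 0) (n : ℕ) :
    (x ⊓ t n - y)⁺ ≤ ∑ i ∈ Finset.range n, (x - t i)⁺ ⊓ (t (i + 1) - y)⁺ := by
  induction n with
  | zero =>
    rw [ht0, Finset.sum_range_zero, posPart_nonpos]
    exact (sub_le_sub inf_le_right hy).trans_eq (sub_zero 0)
  | succ n ih =>
    rw [Finset.sum_range_succ]
    exact (posPart_inf_sub_le_add x _ _ y).trans (add_le_add_left ih _)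

/-- Where `x` exceeds `y` by more than one grid step, a grid level separates them. Lowering `x` by
one step first turns the adjacent levels `t i` and `t (i + 1)` of the previous bound into the same
level. -/
theorem posPart_sub_le_add_sum {x y v : E} [Module ℝ E] [IsOrderedModule ℝ E] (hv : 0 ≤ v)
    (hxv : x ≤ v) (hy : 0 ≤ y) (n : ℕ) :
    (x - y)⁺ ≤ (1 / (n + 1) : ℝ) • v + ∑ i ∈ Finset.range (n + 1),
      (x - ((i + 1 : ℕ) / (n + 1) : ℝ) • v)⁺ ⊓ (((i + 1 : ℕ) / (n + 1) : ℝ) • v - y)⁺ := by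
  have hn : (0 : ℝ) < n + 1 := by positivity
  have hδ : 0 ≤ (1 / (n + 1) : ℝ) • v := smul_nonneg (by positivity) hv
  have h := posPart_inf_sub_le_sum (x - (1 / (n + 1) : ℝ) • v) hy
    (t := fun i => (i / (n + 1) : ℝ) • v) (by simp) (n + 1)
  have h1 : (((n + 1 : ℕ) : ℝ) / (n + 1)) • v = v := by
    rw [Nat.cast_add_one, div_self hn.ne', one_smul]
  have h2 : ∀ i : ℕ, x - (1 / (n + 1) : ℝ) • v - (i / (n + 1) : ℝ) • v =
      x - ((i + 1 : ℕ) / (n + 1) : ℝ) • v := fun i => by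
    rw [sub_sub, ← add_smul, ← add_div, Nat.cast_add_one, add_comm (1 : ℝ)]
  simp only [h1, h2] at h
  rw [inf_eq_left.2 ((sub_le_self x hδ).trans hxv)] at h
  refine le_trans ?_ (add_le_add_right h _)
  refine sup_le ?_ (add_nonneg hδ (posPart_nonneg _))
  calc x - y = (1 / (n + 1) : ℝ) • v + (x - (1 / (n + 1) : ℝ) • v - y) := by abel
    _ ≤ _ := add_le_add_right (le_posPart _) _

end LatticeInequalities

/-! ### A strictly convex energy on an order interval -/

section StrictConvexity

variable {E : Type u} [NormedAddCommGroup E] [NormedSpace ℝ E] [Lattice E]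

/-- Weights on `ℕ × ℕ` with finite sum. -/
noncomputable def gridWeight (p : ℕ × ℕ) : ℝ := (1 / 2) ^ p.1 * (1 / 2) ^ p.2

theorem gridWeight_pos (p : ℕ × ℕ) : 0 < gridWeight p := by
  unfold gridWeight; positivity

theorem summable_gridWeight : Summable gridWeight :=
  summable_geometric_two.mul_of_nonneg summable_geometric_two (fun _ => by positivity)
    fun _ => by positivity

/-- A convex functional on `[0, v]`, a substitute for the integral of `x² / v` against `F`. -/
noncomputable def gridEnergy (F : E →L[ℝ] ℝ) (v x : E) : ℝ :=
  ∑' p : ℕ × ℕ, gridWeight p * F (x - (p.2 / (p.1 + 1) : ℝ) • v)⁺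

variable [IsOrderedAddMonoid E] [IsOrderedModule ℝ E] {F : E →L[ℝ] ℝ}

theorem gridEnergy_term_le (hF : IsPositiveFunctional F) {v : E} (hv : 0 ≤ v) {x : E} (hxv : x ≤ v)
    (p : ℕ × ℕ) :
    gridWeight p * F (x - (p.2 / (p.1 + 1) : ℝ) • v)⁺ ≤ gridWeight p * F v := by
  refine mul_le_mul_of_nonneg_left (hF.mono (sup_le ?_ hv)) (gridWeight_pos p).le
  exact (sub_le_self _ (smul_nonneg (by positivity) hv)).trans hxv

omit [IsOrderedAddMonoid E] [IsOrderedModule ℝ E] in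
theorem gridEnergy_term_nonneg (hF : IsPositiveFunctional F) (v x : E) (p : ℕ × ℕ) :
    0 ≤ gridWeight p * F (x - (p.2 / (p.1 + 1) : ℝ) • v)⁺ :=
  mul_nonneg (gridWeight_pos p).le (hF _ (posPart_nonneg _))

theorem gridEnergy_summable (hF : IsPositiveFunctional F) {v : E} (hv : 0 ≤ v) {x : E}
    (hxv : x ≤ v) :
    Summable fun p : ℕ × ℕ => gridWeight p * F (x - (p.2 / (p.1 + 1) : ℝ) • v)⁺ :=
  Summable.of_nonneg_of_le (gridEnergy_term_nonneg hF v x) (gridEnergy_term_le hF hv hxv)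
    (summable_gridWeight.mul_right _)

omit [IsOrderedAddMonoid E] [IsOrderedModule ℝ E] in
theorem gridEnergy_nonneg (hF : IsPositiveFunctional F) (v x : E) : 0 ≤ gridEnergy F v x :=
  tsum_nonneg (gridEnergy_term_nonneg hF v x)

theorem gridEnergy_le (hF : IsPositiveFunctional F) {v : E} (hv : 0 ≤ v) {x : E} (hxv : x ≤ v) :
    gridEnergy F v x ≤ ∑' p, gridWeight p * F v :=
  (gridEnergy_summable hF hv hxv).tsum_le_tsum (gridEnergy_term_le hF hv hxv)
    (summable_gridWeight.mul_right _)

theorem half_add_le {x y v : E} (hx : x ≤ v) (hy : y ≤ v) : (1 / 2 : ℝ) • (x + y) ≤ v := by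
  have h := smul_le_smul_of_nonneg_left (add_le_add hx hy) (show (0 : ℝ) ≤ 1 / 2 by norm_num)
  rwa [← two_smul ℝ v, smul_smul, show (1 / 2 : ℝ) * 2 = 1 by norm_num, one_smul] at h

/-- All terms of the midpoint convexity gap are nonnegative, so the gap dominates each of them; each
is bounded below by `posPart_inf_negPart_le` at its level. -/
theorem gridWeight_mul_le (hF : IsPositiveFunctional F) {v : E} (hv : 0 ≤ v) {x y : E}
    (hx : x ≤ v) (hy : y ≤ v) (p : ℕ × ℕ) :
    gridWeight p * F ((x - (p.2 / (p.1 + 1) : ℝ) • v)⁺ ⊓ ((p.2 / (p.1 + 1) : ℝ) • v - y)⁺) ≤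
      gridEnergy F v x + gridEnergy F v y - 2 * gridEnergy F v ((1 / 2 : ℝ) • (x + y)) := by
  have key : ∀ q : ℕ × ℕ,
      gridWeight q * F ((x - (q.2 / (q.1 + 1) : ℝ) • v)⁺ ⊓ ((q.2 / (q.1 + 1) : ℝ) • v - y)⁺) ≤
      gridWeight q * F (x - (q.2 / (q.1 + 1) : ℝ) • v)⁺ +
      gridWeight q * F (y - (q.2 / (q.1 + 1) : ℝ) • v)⁺ -
      2 * (gridWeight q * F ((1 / 2 : ℝ) • (x + y) - (q.2 / (q.1 + 1) : ℝ) • v)⁺) := by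
    intro q
    set w := (q.2 / (q.1 + 1) : ℝ) • v
    have h1 := hF.mono (posPart_inf_negPart_le (x - w) (y - w))
    have h2 : (1 / 2 : ℝ) • (x + y) - w = (1 / 2 : ℝ) • (x - w + (y - w)) := by
      module
    rw [h2, posPart_smul_of_nonneg (by norm_num), map_smul, smul_eq_mul]
    rw [map_sub, map_add, ← posPart_neg (y - w), neg_sub] at h1
    have := mul_le_mul_of_nonneg_left h1 (gridWeight_pos q).le
    linarith
  have hs := ((gridEnergy_summable hF hv hx).hasSum.add
    (gridEnergy_summable hF hv hy).hasSum).sub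
    ((gridEnergy_summable hF hv (half_add_le hx hy)).hasSum.mul_left 2)
  refine (key p).trans (le_hasSum hs p fun q _ => le_trans ?_ (key q))
  exact mul_nonneg (gridWeight_pos q).le (hF _ (le_inf (posPart_nonneg _) (posPart_nonneg _)))

/-- Quantitative strict convexity of `gridEnergy` for the seminorm `x ↦ F |x|`. -/
theorem gridEnergy_modulus (hF : IsPositiveFunctional F) {v : E} (hv : 0 ≤ v) {ε : ℝ}
    (hε : 0 < ε) : ∃ η > 0, ∀ x y : E, 0 ≤ x → x ≤ v → 0 ≤ y → y ≤ v →
      gridEnergy F v x + gridEnergy F v y - 2 * gridEnergy F v ((1 / 2 : ℝ) • (x + y)) ≤ η →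
      F |x - y| ≤ ε := by
  obtain ⟨n, hn⟩ := exists_nat_gt (F v / (ε / 4))
  rw [div_lt_iff₀ (by positivity)] at hn
  -- The pair `(n, i + 1)` encodes the level `(i + 1) / (n + 1)`. Dividing by the weights costs the
  -- factor `W` in total.
  set W := ∑ i ∈ Finset.range (n + 1), (gridWeight (n, i + 1))⁻¹
  have hW : 0 < W := Finset.sum_pos (fun i _ => inv_pos.2 (gridWeight_pos _)) ⟨0, by simp⟩
  refine ⟨ε / 4 / W, by positivity, fun x y hx hxv hy hyv h => ?_⟩
  have main : ∀ x y : E, x ≤ v → 0 ≤ y → y ≤ v →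
      gridEnergy F v x + gridEnergy F v y - 2 * gridEnergy F v ((1 / 2 : ℝ) • (x + y)) ≤
        ε / 4 / W → F (x - y)⁺ ≤ ε / 2 := by
    intro x y hxv hy hyv h
    have h1 := hF.mono (posPart_sub_le_add_sum hv hxv hy n)
    rw [map_add, map_smul, smul_eq_mul, map_sum] at h1
    have h2 : (1 / (n + 1) : ℝ) * F v ≤ ε / 4 := by
      rw [one_div, inv_mul_le_iff₀ (by positivity)]
      linarith
    have h3 : ∑ i ∈ Finset.range (n + 1), F ((x - ((i + 1 : ℕ) / (n + 1) : ℝ) • v)⁺ ⊓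
        (((i + 1 : ℕ) / (n + 1) : ℝ) • v - y)⁺) ≤ W * (ε / 4 / W) := by
      rw [Finset.sum_mul]
      refine Finset.sum_le_sum fun i _ => ?_
      rw [le_inv_mul_iff₀ (gridWeight_pos _)]
      exact (gridWeight_mul_le hF hv hxv hyv (n, i + 1)).trans h
    rw [mul_div_cancel₀ _ hW.ne'] at h3
    linarith
  rw [← posPart_add_negPart, map_add, ← posPart_neg (x - y), neg_sub]
  have h1 := main x y hxv hy hyv h
  have h2 := main y x hyv hx hxv (by rw [add_comm y x]; linarith)
  linarith

end StrictConvexity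

/-! ### Completeness of order intervals for `F |·|` -/

section WeakLimits

variable {E : Type u} [NormedAddCommGroup E] [NormedSpace ℝ E] [Lattice E]
  [IsOrderedAddMonoid E] [HasSolidNorm E] [CompleteSpace E]

/-- Order intervals of a KB-space are complete for the seminorm `x ↦ F |x|`. -/
theorem IsKBSpace.exists_tendsto_apply_abs_sub (hE : IsKBSpace E) {F : E →L[ℝ] ℝ}
    (hF : IsPositiveFunctional F) {v : E} {x : ℕ → E} (hx : ∀ k, 0 ≤ x k) (hxv : ∀ k, x k ≤ v)
    (hF' : ∀ k, F |x (k + 1) - x k| ≤ (1 / 2) ^ k) :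
    ∃ a, 0 ≤ a ∧ a ≤ v ∧ Tendsto (fun k => F |x k - a|) atTop (𝓝 0) := by
  have hbound : ∀ m n, partialSups (fun j => x (m + j)) n ≤
      x m + ∑ j ∈ Finset.range n, |x (m + j + 1) - x (m + j)| := by
    intro m n
    induction n with
    | zero => simp
    | succ n ih =>
      have : ∀ k, x (m + k) ≤ x m + ∑ j ∈ Finset.range k, |x (m + j + 1) - x (m + j)| := by
        intro k
        have h := Finset.sum_range_sub (fun j => x (m + j)) k
        have h' : x (m + k) = x m + ∑ j ∈ Finset.range k, (x (m + (j + 1)) - x (m + j)) := by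
          rw [h]; simp
        rw [h']
        exact add_le_add_right (Finset.sum_le_sum fun j _ => le_abs_self _) _
      rw [← Order.succ_eq_add_one, partialSups_succ]
      refine sup_le (ih.trans (add_le_add_right ?_ _)) (this (n + 1))
      exact Finset.sum_le_sum_of_subset_of_nonneg (Finset.range_subset_range.2 (Nat.le_succ n))
        fun j _ _ => abs_nonneg _
  have hsum : ∀ m n, F (partialSups (fun j => x (m + j)) n - x m) ≤ (1 / 2) ^ m * 2 := by
    intro m n
    have h1 := hF.mono (hbound m n)
    rw [map_add, map_sum] at h1
    rw [map_sub]
    have h2 : ∑ j ∈ Finset.range n, F |x (m + j + 1) - x (m + j)| ≤ (1 / 2) ^ m * 2 := by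
      calc _ ≤ ∑ j ∈ Finset.range n, (1 / 2 : ℝ) ^ m * (1 / 2) ^ j :=
            Finset.sum_le_sum fun j _ => (hF' (m + j)).trans_eq (pow_add _ _ _)
        _ = (1 / 2 : ℝ) ^ m * ∑ j ∈ Finset.range n, (1 / 2) ^ j := (Finset.mul_sum ..).symm
        _ ≤ _ := by gcongr; exact sum_geometric_two_le n
    linarith
  have hps : ∀ m n, partialSups (fun j => x (m + j)) n ≤ v := fun m n =>
    partialSups_le _ _ _ fun j _ => hxv _
  have hps0 : ∀ m n, x m ≤ partialSups (fun j => x (m + j)) n := fun m n =>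
    le_partialSups_of_le (fun j => x (m + j)) (Nat.zero_le n)
  -- `s m` is the supremum of the tail from `m`, and the limit `a` below is the limit superior. The
  -- summable jumps keep `F (s m - x m)` at most `2 * (1 / 2) ^ m`.
  choose s hs using fun m => hE.exists_tendsto (C := ‖v‖) (partialSups fun j => x (m + j)).monotone
    fun n => norm_le_norm_of_nonneg_of_le ((hx m).trans (hps0 m n)) (hps m n)
  have hlub : ∀ m, IsLUB (Set.range fun n => partialSups (fun j => x (m + j)) n) (s m) := fun m =>
    isLUB_of_tendsto_atTop (partialSups fun j => x (m + j)).monotone (hs m)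
  have hxs : ∀ m, x m ≤ s m := fun m => (hps0 m 0).trans ((hlub m).1 ⟨0, rfl⟩)
  have hsv : ∀ m, s m ≤ v := fun m => (hlub m).2 (Set.forall_mem_range.2 (hps m))
  have hanti : Antitone s := antitone_nat_of_succ_le fun m => by
    refine (hlub (m + 1)).2 (Set.forall_mem_range.2 fun n => partialSups_le _ _ _ fun j _ => ?_)
    refine le_trans ?_ ((hlub m).1 ⟨j + 1, rfl⟩)
    have : x (m + 1 + j) = x (m + (j + 1)) := by rw [add_assoc, add_comm 1 j]
    rw [this]
    exact le_partialSups (fun j => x (m + j)) (j + 1)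
  obtain ⟨a, ha⟩ := hE.exists_tendsto_of_antitone hanti fun m => (hx m).trans (hxs m)
  refine ⟨a, ge_of_tendsto' ha fun m => (hx m).trans (hxs m), le_of_tendsto' ha hsv, ?_⟩
  have hFs : ∀ m, F (s m - x m) ≤ (1 / 2) ^ m * 2 := fun m =>
    le_of_tendsto' ((F.continuous.tendsto _).comp ((hs m).sub_const (x m))) (hsum m)
  have h1 : Tendsto (fun m : ℕ => (1 / 2 : ℝ) ^ m * 2) atTop (𝓝 0) := by
    simpa using (tendsto_pow_atTop_nhds_zero_of_lt_one (r := (1 / 2 : ℝ)) (by norm_num)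
      (by norm_num)).mul_const 2
  have h2 : Tendsto (fun m => F (s m - a)) atTop (𝓝 0) := by
    have h := (F.continuous.tendsto _).comp (ha.sub_const a)
    rwa [sub_self, map_zero] at h
  refine squeeze_zero (fun m => hF _ (abs_nonneg _)) (fun m => ?_) (zero_add (0 : ℝ) ▸ h1.add h2)
  have has : a ≤ s m := hanti.le_of_tendsto ha m
  have : |x m - a| ≤ (s m - x m) + (s m - a) := by
    refine abs_le'.2 ⟨?_, ?_⟩
    · exact (sub_le_sub_right (hxs m) a).trans (le_add_of_nonneg_left (sub_nonneg.2 (hxs m)))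
    · rw [neg_sub]
      exact (sub_le_sub_right has _).trans (le_add_of_nonneg_right (sub_nonneg.2 has))
  calc F |x m - a| ≤ F (s m - x m) + F (s m - a) := by rw [← map_add]; exact hF.mono this
    _ ≤ _ := by gcongr; exact hFs m

end WeakLimits

/-! ### Weak limits along ultrafilters and weak sequential completeness -/

section UltrafilterLimits

variable {E : Type u} [NormedAddCommGroup E] [NormedSpace ℝ E] [Lattice E]
  [IsOrderedAddMonoid E] [IsOrderedModule ℝ E]

theorem exists_le_of_forall_pos (η : ℕ → ℝ) (hη : ∀ i, 0 < η i) (k : ℕ) :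
    ∃ θ > 0, ∀ i ≤ k, θ ≤ η i := by
  induction k with
  | zero => exact ⟨η 0, hη 0, fun i hi => by rw [Nat.le_zero.1 hi]⟩
  | succ k ih =>
    obtain ⟨θ, hθ, h⟩ := ih
    refine ⟨min θ (η (k + 1)), lt_min hθ (hη _), fun i hi => ?_⟩
    rcases Nat.le_succ_iff.1 hi with hi | rfl
    · exact (min_le_left _ _).trans (h i hi)
    · exact min_le_right _ _

theorem convexHull_image_subset_Icc {z : ℕ → E} {v : E} (hz : ∀ n, 0 ≤ z n) (hzv : ∀ n, z n ≤ v)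
    (A : Set ℕ) : convexHull ℝ (z '' A) ⊆ Set.Icc 0 v :=
  convexHull_min (Set.image_subset_iff.2 fun n _ => ⟨hz n, hzv n⟩) (convex_Icc 0 v)

/-- The limiting minimal energy of convex combinations along an ultrafilter. -/
theorem exists_limit_energy {F : E →L[ℝ] ℝ} (hF : IsPositiveFunctional F) {v : E}
    {z : ℕ → E} (hz : ∀ n, 0 ≤ z n) (hzv : ∀ n, z n ≤ v) (U : Ultrafilter ℕ) :
    ∃ L : ℝ, (∀ B ∈ U, ∀ η > 0, ∃ x ∈ convexHull ℝ (z '' B), gridEnergy F v x < L + η) ∧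
      ∀ η > 0, ∃ A ∈ U, ∀ x ∈ convexHull ℝ (z '' A), L - η < gridEnergy F v x := by
  have hv : 0 ≤ v := (hz 0).trans (hzv 0)
  obtain ⟨L, hL⟩ : ∃ L, IsLUB
      {c | ∃ A ∈ U, ∀ x ∈ convexHull ℝ (z '' A), c ≤ gridEnergy F v x} L := by
    refine Real.exists_isLUB ⟨0, Set.univ, univ_mem, fun x _ => gridEnergy_nonneg hF v x⟩
      ⟨∑' p, gridWeight p * F v, ?_⟩
    rintro c ⟨A, hA, h⟩
    obtain ⟨n, hn⟩ := U.nonempty_of_mem hA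
    exact (h _ (subset_convexHull ℝ _ ⟨n, hn, rfl⟩)).trans (gridEnergy_le hF hv (hzv n))
  refine ⟨L, fun B hB η hη => ?_, fun η hη => ?_⟩
  · by_contra! h
    have := hL.1 ⟨B, hB, h⟩
    linarith
  · obtain ⟨c, ⟨A, hA, h⟩, hc, -⟩ := hL.exists_between (sub_lt_self L hη)
    exact ⟨A, hA, fun x hx => hc.trans_le (h x hx)⟩

/-- Energy-minimizing convex combinations along an ultrafilter are Cauchy for `x ↦ F |x|`. -/
theorem exists_forall_apply_abs_sub_le {F : E →L[ℝ] ℝ} (hF : IsPositiveFunctional F) {v : E}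
    {z : ℕ → E} (hz : ∀ n, 0 ≤ z n) (hzv : ∀ n, z n ≤ v) (U : Ultrafilter ℕ) :
    ∃ x : ℕ → E, (∀ k, x k ∈ Set.Icc 0 v) ∧ (∀ k, F |x (k + 1) - x k| ≤ (1 / 2) ^ k) ∧
      ∀ B ∈ U, ∀ k, ∃ y ∈ convexHull ℝ (z '' B), F |y - x k| ≤ (1 / 2) ^ k := by
  have hv : 0 ≤ v := (hz 0).trans (hzv 0)
  have hsub := convexHull_image_subset_Icc hz hzv
  obtain ⟨L, hex, hlow⟩ := exists_limit_energy hF hz hzv U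
  choose η hη hmod using fun k : ℕ => gridEnergy_modulus hF hv
    (show (0 : ℝ) < (1 / 2) ^ k by positivity)
  -- Two points of energy below `L + η k / 4`, with midpoint energy above `L - η k / 4`, have
  -- convexity gap below `η k`.
  choose A hAU hAL using fun k => hlow (η k / 4) (by have := hη k; positivity)
  have hclose : ∀ k, ∀ x ∈ convexHull ℝ (z '' A k), ∀ y ∈ convexHull ℝ (z '' A k),
      gridEnergy F v x < L + η k / 4 → gridEnergy F v y < L + η k / 4 →
      F |x - y| ≤ (1 / 2) ^ k := by
    intro k x hx y hy hxL hyL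
    refine hmod k x y (hsub _ hx).1 (hsub _ hx).2 (hsub _ hy).1 (hsub _ hy).2 ?_
    have hm : (1 / 2 : ℝ) • (x + y) ∈ convexHull ℝ (z '' A k) := by
      rw [smul_add]
      exact convex_convexHull ℝ _ hx hy (by norm_num) (by norm_num) (by norm_num)
    linarith [hAL k _ hm]
  -- Meeting all requirements up to `k` lets `x (k + 1)` be compared with `x k` at stage `k`.
  have hx : ∀ k, ∃ x ∈ convexHull ℝ (z '' ⋂ i ≤ k, A i), ∀ i ≤ k,
      gridEnergy F v x < L + η i / 4 := by
    intro k
    obtain ⟨θ, hθ, hθη⟩ := exists_le_of_forall_pos (fun i => η i / 4)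
      (fun i => by have := hη i; positivity) k
    obtain ⟨x, hx, hxL⟩ := hex (⋂ i ≤ k, A i)
      ((Filter.biInter_mem (Set.finite_le_nat k)).2 fun i _ => hAU i) θ hθ
    exact ⟨x, hx, fun i hi => by linarith [hθη i hi]⟩
  choose x hx hxL using hx
  have hxA : ∀ k, ∀ i ≤ k, x k ∈ convexHull ℝ (z '' A i) := fun k i hi =>
    convexHull_mono (Set.image_mono (Set.iInter₂_subset i hi)) (hx k)
  refine ⟨x, fun k => hsub _ (hx k), fun k => ?_, fun B hB k => ?_⟩
  · exact hclose k _ (hxA (k + 1) k (Nat.le_succ k)) _ (hxA k k le_rfl)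
      (hxL (k + 1) k (Nat.le_succ k)) (hxL k k le_rfl)
  · obtain ⟨y, hy, hyL⟩ := hex (A k ∩ B) (inter_mem (hAU k) hB) (η k / 4)
      (by have := hη k; positivity)
    exact ⟨y, convexHull_mono (Set.image_mono Set.inter_subset_right) hy,
      hclose k _ (convexHull_mono (Set.image_mono Set.inter_subset_left) hy) _ (hxA k k le_rfl)
        hyL (hxL k k le_rfl)⟩

variable [HasSolidNorm E] [CompleteSpace E]

omit [IsOrderedModule ℝ E] [HasSolidNorm E] [CompleteSpace E] in
theorem IsPositiveFunctional.exists_tendsto_ultrafilter {g : E →L[ℝ] ℝ}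
    (hg : IsPositiveFunctional g) {v : E} {z : ℕ → E} (hz : ∀ n, 0 ≤ z n) (hzv : ∀ n, z n ≤ v)
    (U : Ultrafilter ℕ) : ∃ ℓ, Tendsto (fun n => g (z n)) U (𝓝 ℓ) := by
  obtain ⟨ℓ, -, hℓ⟩ := (isCompact_Icc (a := (0 : ℝ)) (b := g v)).ultrafilter_le_nhds
    (U.map fun n => g (z n)) (Filter.le_principal_iff.2 (Ultrafilter.mem_map.2
      (Filter.Eventually.of_forall fun n => ⟨hg _ (hz n), hg.mono (hzv n)⟩)))
  exact ⟨ℓ, hℓ⟩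

/-- Where `g (z n)` is close to its `U`-limit on `B ∈ U`, so is `g` on the convex hull of `z '' B`.
That hull has a point `F`-close to `x k`, hence to `a`, and `|g w| ≤ F |w|` carries the estimate
over. -/
theorem IsKBSpace.exists_ultrafilter_limit_of_le (hE : IsKBSpace E) {F : E →L[ℝ] ℝ}
    (hF : IsPositiveFunctional F) {v : E} {z : ℕ → E} (hz : ∀ n, 0 ≤ z n) (hzv : ∀ n, z n ≤ v)
    (U : Ultrafilter ℕ) :
    ∃ a ∈ Set.Icc 0 v, ∀ g : E →L[ℝ] ℝ, IsPositiveFunctional g → IsPositiveFunctional (F - g) →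
      Tendsto (fun n => g (z n)) U (𝓝 (g a)) := by
  obtain ⟨x, hx, hxF, hxB⟩ := exists_forall_apply_abs_sub_le hF hz hzv U
  obtain ⟨a, ha, hav, hlim⟩ := hE.exists_tendsto_apply_abs_sub hF (fun k => (hx k).1)
    (fun k => (hx k).2) hxF
  refine ⟨a, ⟨ha, hav⟩, fun g hg hFg => ?_⟩
  obtain ⟨ℓ, hℓ⟩ := hg.exists_tendsto_ultrafilter hz hzv U
  have hgF : ∀ w, |g w| ≤ F |w| := fun w =>
    (hg.abs_apply_le w).trans (hFg.apply_le_of_sub (abs_nonneg w))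
  suffices h : |ℓ - g a| ≤ 0 by
    rwa [← sub_eq_zero.1 (abs_nonpos_iff.1 h)]
  refine le_of_forall_pos_le_add fun ε hε => ?_
  rw [zero_add]
  have hpow : Tendsto (fun k : ℕ => (1 / 2 : ℝ) ^ k) atTop (𝓝 0) :=
    tendsto_pow_atTop_nhds_zero_of_lt_one (by norm_num) (by norm_num)
  obtain ⟨k, hk1, hk2⟩ := ((hpow.eventually_lt_const (show 0 < ε / 3 by positivity)).and
    (hlim.eventually_lt_const (show 0 < ε / 3 by positivity))).exists
  obtain ⟨y, hy, hyF⟩ := hxB _ (hℓ (Metric.closedBall_mem_nhds ℓ (show 0 < ε / 3 by positivity))) k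
  have hyℓ : |g y - ℓ| ≤ ε / 3 := by
    have hconv : Convex ℝ (g ⁻¹' Metric.closedBall ℓ (ε / 3)) :=
      (convex_closedBall ℓ (ε / 3)).linear_preimage (g : E →ₗ[ℝ] ℝ)
    have := convexHull_min (Set.image_subset_iff.2 fun n hn => hn) hconv hy
    rwa [Set.mem_preimage, Metric.mem_closedBall, Real.dist_eq] at this
  have h2 := (hgF (y - x k)).trans hyF
  have h3 := hgF (x k - a)
  rw [map_sub] at h2 h3
  have e1 := abs_le.1 hyℓ
  have e2 := abs_le.1 h2
  have e3 := abs_le.1 h3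
  exact abs_le.2 ⟨by linarith, by linarith⟩

/-- Sequences in order intervals of a KB-space have weak limits along ultrafilters. -/
theorem IsKBSpace.exists_ultrafilter_limit (hE : IsKBSpace E) {v : E} {z : ℕ → E}
    (hz : ∀ n, 0 ≤ z n) (hzv : ∀ n, z n ≤ v) (U : Ultrafilter ℕ) :
    ∃ a, 0 ≤ a ∧ ∀ f : E →L[ℝ] ℝ, IsPositiveFunctional f →
      Tendsto (fun n => f (z n)) U (𝓝 (f a)) := by
  let S : (E →L[ℝ] ℝ) → Set E := fun F => {x | x ∈ Set.Icc 0 v ∧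
    ∀ g : E →L[ℝ] ℝ, IsPositiveFunctional g → IsPositiveFunctional (F - g) →
      Tendsto (fun n => g (z n)) U (𝓝 (g x))}
  have hself : ∀ {F : E →L[ℝ] ℝ}, IsPositiveFunctional F → ∀ {x}, x ∈ S F →
      Tendsto (fun n => F (z n)) U (𝓝 (F x)) := fun hF x hx =>
    hx.2 _ hF (by rw [sub_self]; exact isPositiveFunctional_zero)
  have hinf : ∀ F, IsPositiveFunctional F → ∀ x ∈ S F, ∀ y ∈ S F, x ⊓ y ∈ S F := by
    intro F hF x hx y hy
    refine ⟨⟨le_inf hx.1.1 hy.1.1, inf_le_left.trans hx.1.2⟩, fun g hg hFg => ?_⟩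
    -- Some functional in `[0, F]` attains `F (x - y)⁺` at `x - y`, but all of them agree at `x` and
    -- `y`, both values being the same `U`-limit.
    have h0 : F (x - y)⁺ = 0 := by
      obtain ⟨g', hg', hFg', h⟩ := hF.exists_apply_eq_posPart (x - y)
      rw [← h, map_sub, sub_eq_zero]
      exact tendsto_nhds_unique (hx.2 g' hg' hFg') (hy.2 g' hg' hFg')
    have h1 : g (x - y)⁺ = 0 := le_antisymm
      ((hFg.apply_le_of_sub (posPart_nonneg _)).trans_eq h0) (hg _ (posPart_nonneg _))
    rw [inf_eq_sub_posPart_sub, map_sub, h1, sub_zero]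
    exact hx.2 g hg hFg
  have hleast : ∀ F, IsPositiveFunctional F → ∃ a, IsLeast (S F) a := by
    intro F hF
    have : Nonempty (S F)ᵒᵈ := by
      obtain ⟨a, ha⟩ := hE.exists_ultrafilter_limit_of_le hF hz hzv U
      exact ⟨OrderDual.toDual ⟨a, ha⟩⟩
    let x : (S F)ᵒᵈ → E := fun i => (OrderDual.ofDual i).1
    have hdir : IsDirectedOrder (S F)ᵒᵈ := ⟨fun i j =>
      ⟨OrderDual.toDual ⟨x i ⊓ x j, hinf F hF _ i.2 _ j.2⟩, inf_le_left, inf_le_right⟩⟩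
    have hanti : Antitone x := fun i j hij => hij
    obtain ⟨a, ha⟩ := hE.exists_tendsto_of_antitone hanti fun i => i.2.1.1
    refine ⟨a, ⟨⟨ge_of_tendsto' ha fun i => i.2.1.1, le_of_tendsto' ha fun i => i.2.1.2⟩,
      fun g hg hFg => ?_⟩, fun y hy => hanti.le_of_tendsto ha (OrderDual.toDual ⟨y, hy⟩)⟩
    obtain ⟨i₀⟩ := ‹Nonempty (S F)ᵒᵈ›
    -- Functionals in `[0, F]` are constant on `S F`, so the norm limit of the decreasing net stays
    -- in `S F`.
    have hconst : ∀ i, g (x i) = g (x i₀) := fun i =>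
      tendsto_nhds_unique (i.2.2 g hg hFg) (i₀.2.2 g hg hFg)
    have : g a = g (x i₀) := by
      refine tendsto_nhds_unique ((g.continuous.tendsto a).comp ha) ?_
      simp only [Function.comp_def, hconst]
      exact tendsto_const_nhds
    rw [this]
    exact i₀.2.2 g hg hFg
  choose! m hm using hleast
  have hSanti : ∀ F G, IsPositiveFunctional G → S (F + G) ⊆ S F := fun F G hG x hx =>
    ⟨hx.1, fun g hg hFg => hx.2 g hg (by convert hFg.add hG using 1; abel)⟩
  have hmono : ∀ F G, IsPositiveFunctional F → IsPositiveFunctional G → m F ≤ m (F + G) :=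
    fun F G hF hG => (hm F hF).2 (hSanti F G hG (hm _ (hF.add hG)).1)
  have hmono' : ∀ F G, IsPositiveFunctional F → IsPositiveFunctional G → m G ≤ m (F + G) :=
    fun F G hF hG => by rw [add_comm]; exact hmono G F hG hF
  let T : Set E := {x | ∃ F, IsPositiveFunctional F ∧ m F = x}
  have hT : DirectedOn (· ≤ ·) T := by
    rintro _ ⟨F, hF, rfl⟩ _ ⟨G, hG, rfl⟩
    exact ⟨m (F + G), ⟨F + G, hF.add hG, rfl⟩, hmono F G hF hG, hmono' F G hF hG⟩
  have hTne : T.Nonempty := ⟨m 0, 0, isPositiveFunctional_zero, rfl⟩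
  obtain ⟨a, ha, hlim⟩ := hE.exists_isLUB_tendsto hTne hT (C := ‖v‖) (by
    rintro _ ⟨F, hF, rfl⟩
    exact norm_le_norm_of_nonneg_of_le (hm F hF).1.1.1 (hm F hF).1.1.2)
  refine ⟨a, (hm 0 isPositiveFunctional_zero).1.1.1.trans
    (ha.1 ⟨0, isPositiveFunctional_zero, rfl⟩), fun f hf => ?_⟩
  -- Both `m (f + G)` and `m f` lie in `S f`, so `f` takes one value on them; since `m G ≤ m (f +
  -- G)`, this bounds `f` on all of `T`.
  have hval : f a = f (m f) := by
    have : Nonempty T := hTne.to_subtype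
    have : IsDirectedOrder T := ⟨directedOn_iff_directed.1 hT⟩
    refine le_antisymm ?_ (hf.mono (ha.1 ⟨f, hf, rfl⟩))
    refine le_of_tendsto' ((f.continuous.tendsto a).comp hlim) ?_
    rintro ⟨_, G, hG, rfl⟩
    refine (hf.mono (hmono' f G hf hG)).trans_eq ?_
    exact tendsto_nhds_unique (hself hf (hSanti f G hG (hm _ (hf.add hG)).1))
      (hself hf (hm f hf).1)
  rw [hval]
  exact hself hf (hm f hf).1

/-- A norm bounded sequence of positive vectors in a KB-space has a limit along an ultrafilter,
after truncation by `v`, when `v` increases. -/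
theorem IsKBSpace.exists_truncated_limit (hE : IsKBSpace E) {y : ℕ → E} (hy : ∀ n, 0 ≤ y n)
    {C : ℝ} (hC : ∀ n, ‖y n‖ ≤ C) (U : Ultrafilter ℕ) :
    ∃ (p : Set.Ici (0 : E) → E) (a : E), Tendsto p atTop (𝓝 a) ∧
      ∀ v, ∀ f : E →L[ℝ] ℝ, IsPositiveFunctional f →
        Tendsto (fun n => f (y n ⊓ v.1)) U (𝓝 (f (p v))) := by
  choose p hp0 hp using fun v : Set.Ici (0 : E) => hE.exists_ultrafilter_limit
    (z := fun n => y n ⊓ v.1) (fun n => le_inf (hy n) v.2) (fun n => inf_le_right) U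
  -- Positive functionals detect the order, so inequalities between truncations pass to their weak
  -- limits.
  have hmono : Monotone p := by
    intro v w hvw
    rw [← sub_nonneg]
    refine nonneg_of_forall_isPositiveFunctional fun f hf => ?_
    rw [map_sub, sub_nonneg]
    exact le_of_tendsto_of_tendsto' (hp v f hf) (hp w f hf) fun n =>
      hf.mono (inf_le_inf_left _ hvw)
  have hbound : ∀ v, ‖p v‖ ≤ C := fun v => by
    refine norm_le_of_forall_apply_le ((norm_nonneg _).trans (hC 0)) fun f => ?_
    refine le_of_tendsto' (tendsto_of_forall_isPositiveFunctional (hp v) f) fun n => ?_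
    refine (le_abs_self _).trans ((f.le_opNorm _).trans ?_)
    gcongr
    exact (norm_le_norm_of_nonneg_of_le (le_inf (hy n) v.2) inf_le_left).trans (hC n)
  obtain ⟨a, ha⟩ := hE.exists_tendsto hmono hbound
  exact ⟨p, a, ha, hp⟩

/-- The truncated positive and negative parts have weak `U`-limits `p v` and `q v`, converging in
norm to `a` and `b` as `v` grows. Uniform integrability bounds the truncation error against `f` for
all large `n` and `v`. As `f (y n)` already converges, its limit must be `f (a - b)`. -/
theorem IsKBSpace.isWeaklySequentiallyComplete (hE : IsKBSpace E) :
    IsWeaklySequentiallyComplete E := by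
  intro y hy
  obtain ⟨C, -, hC⟩ := exists_norm_le_of_weaklyCauchy hy
  let U : Ultrafilter ℕ := Ultrafilter.of atTop
  have hU : (U : Filter ℕ) ≤ atTop := Ultrafilter.of_le atTop
  obtain ⟨p, a, ha, hp⟩ := hE.exists_truncated_limit (y := fun n => (y n)⁺)
    (fun n => posPart_nonneg _) (fun n => (norm_posPart_le _).trans (hC n)) U
  obtain ⟨q, b, hb, hq⟩ := hE.exists_truncated_limit (y := fun n => (-y n)⁺)
    (fun n => posPart_nonneg _)
    (fun n => (norm_posPart_le _).trans ((norm_neg (y n)).trans_le (hC n))) U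
  have key : ∀ f : E →L[ℝ] ℝ, IsPositiveFunctional f →
      Tendsto (fun n => f (y n)) atTop (𝓝 (f (a - b))) := by
    intro f hf
    obtain ⟨ℓ, hℓ⟩ := cauchySeq_tendsto_of_complete (hy f)
    suffices h : |ℓ - f (a - b)| ≤ 0 by
      rwa [← sub_eq_zero.1 (abs_nonpos_iff.1 h)]
    refine le_of_forall_pos_le_add fun ε hε => ?_
    rw [zero_add]
    obtain ⟨v₀, hv₀, hv⟩ := hf.exists_forall_apply_posPart_le hy (half_pos hε)
    -- The bound by `ε` is closed, so it passes first to the limit in `n` along `U` and then to the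
    -- limit in `v`.
    have hlim : Tendsto (fun v => |ℓ - f (p v - q v)|) atTop (𝓝 |ℓ - f (a - b)|) :=
      (((f.continuous.tendsto _).comp (ha.sub hb)).const_sub ℓ).abs
    refine le_of_tendsto hlim ?_
    filter_upwards [eventually_ge_atTop (⟨v₀, hv₀⟩ : Set.Ici (0 : E))] with v hv₀v
    have hlim' : Tendsto (fun n => |f (y n) - (f ((y n)⁺ ⊓ v.1) - f ((-y n)⁺ ⊓ v.1))|) U
        (𝓝 |ℓ - f (p v - q v)|) := by
      rw [map_sub]
      exact ((hℓ.mono_left hU).sub ((hp v f hf).sub (hq v f hf))).abs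
    refine le_of_tendsto hlim' ?_
    filter_upwards [hU hv] with n hn
    have htail : ∀ x : E, x⁺ ≤ |y n| → f (x⁺ - v.1)⁺ ≤ ε / 2 := fun x hx =>
      (hf.mono (posPart_mono (sub_le_sub hx hv₀v))).trans hn
    have h1 := htail (y n) (posPart_le_abs _)
    have h2 := htail (-y n) ((posPart_le_abs _).trans_eq (abs_neg _))
    have h1' := hf _ (posPart_nonneg ((y n)⁺ - v.1))
    have h2' := hf _ (posPart_nonneg ((-y n)⁺ - v.1))
    have e : f (y n) = f (y n)⁺ - f (-y n)⁺ := by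
      rw [posPart_neg, ← map_sub, posPart_sub_negPart]
    rw [inf_eq_sub_posPart_sub, inf_eq_sub_posPart_sub, map_sub, map_sub, e]
    exact abs_le.2 ⟨by linarith, by linarith⟩
  refine ⟨a - b, ?_⟩
  exact (WeakBilin.tendsto_iff_forall_eval_tendsto _
    (separatingDual_iff_injective.1 inferInstance)).2
    (tendsto_of_forall_isPositiveFunctional key)

end UltrafilterLimits

theorem mainTheorem4 (E : Type u) [NormedAddCommGroup E] [NormedSpace ℝ E] [CompleteSpace E]
    [Lattice E] [IsOrderedAddMonoid E] [IsOrderedModule ℝ E] [HasSolidNorm E]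
    (hE : IsPPSLattice E) :
    IsKBSpace E ∧ HasOrderContinuousNorm E ∧ IsWeaklySequentiallyComplete E ∧
      IsDedekindComplete E :=
  have h := hE.isKBSpace
  ⟨h, h.hasOrderContinuousNorm, h.isWeaklySequentiallyComplete, h.isDedekindComplete⟩
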